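/- Let $G$ be a directed graph with nodes $1,\dots,K$ such that every edge $i\to j$ satisfies $i<j$, and let $\mathrm{pa}(k)$ be the set of parents of $k$. Let $\mathcal X=\mathcal X_1\times\dots\times\mathcal X_K$ with $\mathcal X_k=[0,1]^{d_k}$, write $x_I=(x_i)_{i\in I}\in\mathcal X_I=\prod_{i\in I}\mathcal X_i$, and let $\|\cdot\|$ be the $\infty$-norm. For probability measures on one of these spaces, let $\mathcal W(\mu,\nu)=\inf_\pi\int\|x-y\|\,\pi(dx,dy)$, where $\pi$ runs over all couplings of $\mu$ and $\nu$. Let $\mathcal P_G$ be the set of Borel probability measures $\mu$ on $\mathcal X$ with $\mu(dx)=\prod_{k=1}^K\mu(dx_k\mid x_{\mathrm{pa}(k)})$, where $\mu(dx_k\mid x_{\mathrm{pa}(k)})$ is the regular conditional distribution of the $k$-th variable given its parent variables (the $k$-th marginal if $\mathrm{pa}(k)=\emptyset$). Let $L\ge 0$ and $\mu,\nu\in\mathcal P_G$. Fix versions $x_{\mathrm{pa}(k)}\mapsto\mu(\cdot\mid x_{\mathrm{pa}(k)})$ and $x_{\mathrm{pa}(k)}\mapsto\nu(\cdot\mid x_{\mathrm{pa}(k)})$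 of these conditional distributions, defined as probability kernels on all of $\mathcal X_{\mathrm{pa}(k)}$, and assume that for all $2\le k\le K$ and all $x_{\mathrm{pa}(k)},\tilde x_{\mathrm{pa}(k)}\in\mathcal X_{\mathrm{pa}(k)}$, $$\mathcal W\big(\mu(\cdot\mid x_{\mathrm{pa}(k)}),\mu(\cdot\mid\tilde x_{\mathrm{pa}(k)})\big)\le L\,\|x_{\mathrm{pa}(k)}-\tilde x_{\mathrm{pa}(k)}\|.$$ Then $$\mathcal W(\mu,\nu)\le\int\sum_{k=1}^K M_{L,k}\,\mathcal W\big(\mu(\cdot\mid y_{\mathrm{pa}(k)}),\nu(\cdot\mid y_{\mathrm{pa}(k)})\big)\,\nu(dy),\qquad M_{L,k}=1+\sum_{\ell=1}^K a_{k,\ell}L^\ell,$$ where $a_{k,\ell}$ is the number of directed paths with $\ell$ edges in $G$ that start at the node $k$. -/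

import Mathlib

open MeasureTheory ProbabilityTheory
open scoped NNReal ENNReal

/-- The unit cube `[0,1]^n`, with its supremum distance and its Borel sets. -/
abbrev Cube (n : ℕ) : Type := Fin n → unitInterval

/-- The product `𝒳 = ∏ₖ [0,1]^{d k}` over the nodes, with the supremum distance (so that it is
isometric to `[0,1]^{∑ₖ d k}`). -/
abbrev NodeSpace {K : ℕ} (d : Fin K → ℕ) : Type := ∀ k : Fin K, Cube (d k)

open Classical in
/-- The parents of the node `k`: all `j` with an edge `j → k`. -/
noncomputable def parents {K : ℕ} (G : Digraph (Fin K)) (k : Fin K) : Finset (Fin K) :=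
  Finset.univ.filter (fun j => G.Adj j k)

/-- The space `𝒳_{pa(k)}` of the variables at the parents of `k`, with the supremum distance;
it is a one-point space if `k` has no parents. -/
abbrev ParentSpace {K : ℕ} (d : Fin K → ℕ) (G : Digraph (Fin K)) (k : Fin K) : Type :=
  ∀ j : parents G k, Cube (d j)

/-- The projection `x ↦ x_{pa(k)}`. -/
def toParents {K : ℕ} {d : Fin K → ℕ} (G : Digraph (Fin K)) (k : Fin K) (x : NodeSpace d) :
    ParentSpace d G k :=
  fun j => x j

/-- The first order Wasserstein distance: the infimum of `∫ dist(x, y) π(dx, dy)` over all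
couplings `π` of `μ` and `ν`. -/
noncomputable def wasserstein {E : Type*} [PseudoEMetricSpace E] [MeasurableSpace E]
    (μ ν : Measure E) : ℝ≥0∞ :=
  ⨅ (π : Measure (E × E)) (_ : π.map Prod.fst = μ ∧ π.map Prod.snd = ν),
    ∫⁻ p, edist p.1 p.2 ∂π

/-- `κ` is a version of the regular conditional distribution `μ(dx_k | x_{pa(k)})`. If `k` has no
parents, this says that the only value of `κ` is the `k`-th marginal of `μ`. -/
structure IsRegularConditional {K : ℕ} {d : Fin K → ℕ} (G : Digraph (Fin K))
    (μ : Measure (NodeSpace d)) (k : Fin K) (κ : Kernel (ParentSpace d G k) (Cube (d k))) :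
    Prop where
  isMarkovKernel : IsMarkovKernel κ
  disintegration :
    μ.map (fun x => (toParents G k x, x k)) = (μ.map (toParents G k)).compProd κ

/-- The iterated integral `∫ ⋯ ∫ f(z) κ_K(z_{pa(K)}, dz_K) ⋯ κ_1(z_{pa(1)}, dz_1)`; the integral
over the first variable is the outermost one. The variable at node `k` is integrated by replacing
the `k`-th coordinate of the current point. If all edges go from smaller to larger nodes, each
coordinate is replaced before it is read, and the value does not depend on the starting point. -/
noncomputable def iteratedIntegral {K : ℕ} {d : Fin K → ℕ} (G : Digraph (Fin K))
    (κ : ∀ k : Fin K, Kernel (ParentSpace d G k) (Cube (d k)))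
    (f : NodeSpace d → ℝ≥0∞) : NodeSpace d → ℝ≥0∞ :=
  (List.finRange K).foldr
    (fun k g x => ∫⁻ z, g (Function.update x k z) ∂(κ k (toParents G k x))) f

/-- Membership in `𝒫_G` : the probability measure `μ` is the product
`μ(dx) = ∏ₖ μ(dx_k | x_{pa(k)})` of its regular conditional distributions given the parents. -/
def IsGraphicalModel {K : ℕ} {d : Fin K → ℕ} (G : Digraph (Fin K))
    (μ : Measure (NodeSpace d)) : Prop :=
  IsProbabilityMeasure μ ∧
    ∃ κ : ∀ k : Fin K, Kernel (ParentSpace d G k) (Cube (d k)),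
      (∀ k, IsRegularConditional G μ k (κ k)) ∧
      ∀ f : NodeSpace d → ℝ≥0∞, Measurable f →
        ∀ x : NodeSpace d, ∫⁻ y, f y ∂μ = iteratedIntegral G κ f x

/-- The number `a_{k,ℓ}` of directed paths `k = p₀ → p₁ → ⋯ → p_ℓ`, that is, with `ℓ` edges and
starting at `k`. (Vertices cannot repeat along such a sequence in an acyclic graph.) -/
noncomputable def numPaths {K : ℕ} (G : Digraph (Fin K)) (k : Fin K) (ℓ : ℕ) : ℕ :=
  Nat.card {p : Fin (ℓ + 1) → Fin K // p 0 = k ∧ ∀ i : Fin ℓ, G.Adj (p i.castSucc) (p i.succ)}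

/-- The constant `M_{L,k} = 1 + ∑_{ℓ=1}^K a_{k,ℓ} L^ℓ`. -/
noncomputable def pathConstant {K : ℕ} (G : Digraph (Fin K)) (L : ℝ≥0) (k : Fin K) : ℝ≥0 :=
  1 + ∑ ℓ ∈ Finset.Icc 1 K, (numPaths G k ℓ : ℝ≥0) * L ^ ℓ

/-! A coupling of `μ` and `ν` is built node by node. Once the parents of `k` carry a pair (a, b),
the pair at `k` is drawn from an ε-optimal coupling of μ(·|a) and ν(·|b). Each half of the
construction samples its own model, so the marginals are `μ` and `ν` (`map_resampleList_of_map_eq`,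
`resampleList_nodeKernel_eq`).

Let e_k be the expected distance at `k` and w_k the ν-integral of W(μ(·|y), ν(·|y)) over the parent
values y. The triangle inequality through μ(·|b) and the Lipschitz bound give e_k ≤ L ∑ e_j + w_k +
ε, with j running over the parents of `k` (`exists_coupling_lintegral_edist_le`). Unrolling this
along the graph counts directed paths: w_k is charged L^ℓ once for every path of ℓ edges leaving
`k`, and the remainder dies because paths have fewer than K edges (`sum_le_sum_pathConstant_mul`).
The supremum distance is at most ∑ e_k; then ε → 0.

The analytic point is that the ε-optimal couplings must depend measurably on (a, b). They are
selected from a countable family of explicit coupling kernels, whose densities are constant on the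
cells of fine partitions and come from rational matrices (`exists_seq_coupling_kernel`). The same
family shows that the Wasserstein distance of two kernels is measurable in the parameter. -/

/-! ### Sampling coordinates successively. -/

section Resample

variable {ι : Type*} [DecidableEq ι] {E : ι → Type*} [∀ i, MeasurableSpace (E i)]

/-- The kernel that replaces the `k`-th coordinate of `x` by a sample from `κ x`. -/
noncomputable def resample (k : ι) (κ : Kernel (∀ i, E i) (E k)) :
    Kernel (∀ i, E i) (∀ i, E i) :=
  (Kernel.id ×ₖ κ).map (fun p => Function.update p.1 k p.2)

instance (k : ι) (κ : Kernel (∀ i, E i) (E k)) [IsMarkovKernel κ] :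
    IsMarkovKernel (resample k κ) :=
  Kernel.IsMarkovKernel.map _ measurable_update'

theorem lintegral_resample (k : ι) (κ : Kernel (∀ i, E i) (E k)) [IsMarkovKernel κ]
    {f : (∀ i, E i) → ℝ≥0∞} (hf : Measurable f) (x : ∀ i, E i) :
    ∫⁻ y, f y ∂(resample k κ x) = ∫⁻ z, f (Function.update x k z) ∂(κ x) := by
  rw [resample, Kernel.lintegral_map _ measurable_update' _ hf,
    Kernel.lintegral_id_prod (f := fun p => f (Function.update p.1 k p.2))
      (hf.comp measurable_update')]

/-- Resample successively the coordinates in the list, from left to right. -/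
noncomputable def resampleList (κ : ∀ k, Kernel (∀ i, E i) (E k)) :
    List ι → Kernel (∀ i, E i) (∀ i, E i)
  | [] => Kernel.id
  | k :: l => resampleList κ l ∘ₖ resample k (κ k)

theorem resampleList_append (κ : ∀ k, Kernel (∀ i, E i) (E k)) (l₁ l₂ : List ι) :
    resampleList κ (l₁ ++ l₂) = resampleList κ l₂ ∘ₖ resampleList κ l₁ := by
  induction l₁ with
  | nil => simp [resampleList]
  | cons k l ih => simp only [List.cons_append, resampleList, ih, Kernel.comp_assoc]

variable (κ : ∀ k, Kernel (∀ i, E i) (E k)) [∀ k, IsMarkovKernel (κ k)]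

instance isMarkovKernel_resampleList (l : List ι) : IsMarkovKernel (resampleList κ l) := by
  induction l with
  | nil => unfold resampleList; infer_instance
  | cons k l ih => unfold resampleList; infer_instance

theorem lintegral_resampleList_cons (k : ι) (l : List ι) {f : (∀ i, E i) → ℝ≥0∞}
    (hf : Measurable f) (x : ∀ i, E i) :
    ∫⁻ y, f y ∂(resampleList κ (k :: l) x) =
      ∫⁻ z, ∫⁻ y, f y ∂(resampleList κ l (Function.update x k z)) ∂(κ k x) := by
  rw [resampleList, Kernel.lintegral_comp _ _ _ hf, lintegral_resample _ _ hf.lintegral_kernel]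

theorem lintegral_resampleList_of_invariant (l : List ι) {f : (∀ i, E i) → ℝ≥0∞}
    (hf : Measurable f) (hl : ∀ k ∈ l, ∀ x z, f (Function.update x k z) = f x) (x : ∀ i, E i) :
    ∫⁻ y, f y ∂(resampleList κ l x) = f x := by
  induction l generalizing x with
  | nil => simp [resampleList, Kernel.id_apply, lintegral_dirac' _ hf]
  | cons k l ih =>
    rw [lintegral_resampleList_cons _ _ _ hf]
    simp [ih (fun j hj => hl j (List.mem_cons_of_mem _ hj)), hl k List.mem_cons_self]

theorem lintegral_resampleList_append_of_invariant (l₁ l₂ : List ι) {f : (∀ i, E i) → ℝ≥0∞}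
    (hf : Measurable f) (hl : ∀ k ∈ l₂, ∀ x z, f (Function.update x k z) = f x) (x : ∀ i, E i) :
    ∫⁻ y, f y ∂(resampleList κ (l₁ ++ l₂) x) = ∫⁻ y, f y ∂(resampleList κ l₁ x) := by
  rw [resampleList_append, Kernel.lintegral_comp _ _ _ hf]
  simp [lintegral_resampleList_of_invariant κ l₂ hf hl]

theorem map_resampleList_append_of_invariant {B : Type*} [MeasurableSpace B] (l₁ l₂ : List ι)
    {g : (∀ i, E i) → B} (hg : Measurable g)
    (hl : ∀ k ∈ l₂, ∀ x z, g (Function.update x k z) = g x) (x : ∀ i, E i) :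
    (resampleList κ (l₁ ++ l₂) x).map g = (resampleList κ l₁ x).map g := by
  refine Measure.ext_of_lintegral _ fun f hf => ?_
  rw [lintegral_map hf hg, lintegral_map hf hg]
  exact lintegral_resampleList_append_of_invariant κ l₁ l₂ (hf.comp hg)
    (fun k hk x z => by simp [hl k hk]) x

/-- The value of `g` is settled before `k` is drawn, and coordinate `k` is never drawn again. So in
the final law `θ` is still the conditional law of coordinate `k` given `g`. -/
theorem lintegral_resampleList_eval {B : Type*} [MeasurableSpace B] (l₁ l₂ : List ι) (k : ι)
    (hk : k ∉ l₂) {g : (∀ i, E i) → B} (hg : Measurable g)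
    (hl : ∀ j ∈ k :: l₂, ∀ x z, g (Function.update x j z) = g x)
    (θ : Kernel B (E k)) (hθ : ∀ x, κ k x = θ (g x))
    {f : B → E k → ℝ≥0∞} (hf : Measurable (Function.uncurry f)) (x : ∀ i, E i) :
    ∫⁻ y, f (g y) (y k) ∂(resampleList κ (l₁ ++ k :: l₂) x) =
      ∫⁻ y, ∫⁻ z, f (g y) z ∂(θ (g y)) ∂(resampleList κ (l₁ ++ k :: l₂) x) := by
  have hm : Measurable fun y : (∀ i, E i) => f (g y) (y k) :=
    hf.comp (hg.prodMk (measurable_pi_apply k))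
  have : IsMarkovKernel (θ.comap g hg) := ⟨fun y => by
    rw [Kernel.comap_apply, ← hθ]; infer_instance⟩
  have hm' : Measurable fun y : (∀ i, E i) => ∫⁻ z, f (g y) z ∂(θ (g y)) := by
    have : Measurable fun y : (∀ i, E i) => ∫⁻ z, f (g y) z ∂(θ.comap g hg y) :=
      Measurable.lintegral_kernel_prod_right'
        (f := fun p : (∀ i, E i) × E k => f (g p.1) p.2)
        (hf.comp ((hg.comp measurable_fst).prodMk measurable_snd))
    simpa using this
  rw [lintegral_resampleList_append_of_invariant κ l₁ (k :: l₂) hm'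
    (fun j hj x z => by simp [hl j hj]), resampleList_append, Kernel.lintegral_comp _ _ _ hm]
  refine lintegral_congr fun y => ?_
  rw [lintegral_resampleList_cons _ _ _ hm, hθ]
  refine lintegral_congr fun z => ?_
  rw [lintegral_resampleList_of_invariant κ l₂ hm]
  · simp [hl k List.mem_cons_self]
  · intro j hj x z
    have : k ≠ j := fun h => hk (h ▸ hj)
    simp [hl j (List.mem_cons_of_mem _ hj), this]

/-- A kernel matters only up to null sets of the law of the preceding draws. Induction from the
right applies because that law is already known to be the same for both families. -/
theorem resampleList_congr_ae (κ' : ∀ k, Kernel (∀ i, E i) (E k)) [∀ k, IsMarkovKernel (κ' k)]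
    (l : List ι) (x : ∀ i, E i)
    (h : ∀ l₁ k l₂, l = l₁ ++ k :: l₂ → ∀ᵐ y ∂(resampleList κ l₁ x), κ k y = κ' k y) :
    resampleList κ l x = resampleList κ' l x := by
  induction l using List.reverseRecOn with
  | nil => rfl
  | append_singleton l k ih =>
    have ih := ih fun l₁ j l₂ hl => h l₁ j (l₂ ++ [k]) (by simp [hl])
    refine Measure.ext_of_lintegral _ fun f hf => ?_
    rw [resampleList_append, resampleList_append, Kernel.lintegral_comp _ _ _ hf,
      Kernel.lintegral_comp _ _ _ hf, ← ih]
    refine lintegral_congr_ae ?_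
    filter_upwards [h l k [] rfl] with y hy
    rw [lintegral_resampleList_cons _ _ _ hf, lintegral_resampleList_cons _ _ _ hf, hy]
    rfl

end Resample

/-! ### Discrete transport plans as densities. -/

section TransportDensity

variable {I : Type*} [Fintype I]

/-- Given weights `a`, `b` on the cells of a partition and a matrix `Q` such that `Q i j * a i * b j`
is the mass of a partial transport plan with marginals dominated by `a`, `b` and total mass less
than one, this is the density (with respect to the product of `a` and `b`) of the completion of the
plan by the normalized product of the remaining masses. The density is `1` for other matrices. -/
noncomputable def transportDensity (Q : I → I → ℝ≥0) (a b : I → ℝ≥0∞) (i j : I) : ℝ≥0∞ :=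
  open Classical in
  if (∀ i, ∑ j, Q i j * b j ≤ 1) ∧ (∀ j, ∑ i, Q i j * a i ≤ 1) ∧ ∑ i, ∑ j, Q i j * a i * b j < 1
  then Q i j + (1 - ∑ j, Q i j * b j) * (1 - ∑ i, Q i j * a i) / (1 - ∑ i, ∑ j, Q i j * a i * b j)
  else 1

theorem transportDensity_swap (Q : I → I → ℝ≥0) (a b : I → ℝ≥0∞) (i j : I) :
    transportDensity (fun i j => Q j i) b a j i = transportDensity Q a b i j := by
  have h : ∑ j, ∑ i, (Q i j : ℝ≥0∞) * b j * a i = ∑ i, ∑ j, Q i j * a i * b j := by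
    rw [Finset.sum_comm]
    exact Finset.sum_congr rfl fun _ _ => Finset.sum_congr rfl fun _ _ => by ring
  unfold transportDensity
  rw [h]
  congr 1
  · exact propext ⟨fun h => ⟨h.2.1, h.1, h.2.2⟩, fun h => ⟨h.2.1, h.1, h.2.2⟩⟩
  · ring_nf

/-- The correction term adds back exactly the deficit of row `i`, since the column deficits weighted
by `b` sum to the missing mass by which they are divided. -/
theorem sum_transportDensity_mul (Q : I → I → ℝ≥0) (a b : I → ℝ≥0∞) (hb : ∑ j, b j = 1) (i : I) :
    ∑ j, transportDensity Q a b i j * b j = 1 := by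
  unfold transportDensity
  split_ifs with h
  · obtain ⟨h1, h2, h3⟩ := h
    set m := ∑ i, ∑ j, (Q i j : ℝ≥0∞) * a i * b j with hm
    have h4 : ∑ j, (1 - ∑ i, (Q i j : ℝ≥0∞) * a i) * b j = 1 - m := by
      refine ENNReal.eq_sub_of_add_eq h3.ne_top ?_
      rw [hm, Finset.sum_comm, ← Finset.sum_add_distrib]
      conv_rhs => rw [← hb]
      refine Finset.sum_congr rfl fun j _ => ?_
      rw [← Finset.sum_mul, ← add_mul, tsub_add_cancel_of_le (h2 j), one_mul]
    have h5 : 1 - m ≠ 0 := (tsub_pos_of_lt h3).ne'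
    have h6 : 1 - m ≠ ⊤ := ENNReal.sub_ne_top ENNReal.one_ne_top
    calc _ = ∑ j, (Q i j * b j + (1 - ∑ j, Q i j * b j) / (1 - m) *
          ((1 - ∑ i, (Q i j : ℝ≥0∞) * a i) * b j)) := by
          refine Finset.sum_congr rfl fun j _ => ?_
          simp only [div_eq_mul_inv]; ring
      _ = 1 := by
          rw [Finset.sum_add_distrib, ← Finset.mul_sum, h4, ENNReal.div_mul_cancel h5 h6,
            add_tsub_cancel_of_le (h1 i)]
  · simpa using hb

theorem sum_mul_transportDensity (Q : I → I → ℝ≥0) (a b : I → ℝ≥0∞) (ha : ∑ i, a i = 1) (j : I) :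
    ∑ i, transportDensity Q a b i j * a i = 1 := by
  simpa only [transportDensity_swap] using
    sum_transportDensity_mul (fun i j => Q j i) b a ha j

theorem measurable_transportDensity {A : Type*} [MeasurableSpace A] (Q : I → I → ℝ≥0)
    {a b : A → I → ℝ≥0∞} (ha : ∀ i, Measurable fun x => a x i)
    (hb : ∀ i, Measurable fun x => b x i) (i j : I) :
    Measurable fun x => transportDensity Q (a x) (b x) i j := by
  classical
  have h1 : ∀ i, Measurable fun x => ∑ j, (Q i j : ℝ≥0∞) * b x j := fun i => by fun_prop
  have h2 : ∀ j, Measurable fun x => ∑ i, (Q i j : ℝ≥0∞) * a x i := fun i => by fun_prop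
  have h3 : Measurable fun x => ∑ i, ∑ j, (Q i j : ℝ≥0∞) * a x i * b x j := by fun_prop
  unfold transportDensity
  refine Measurable.ite ?_ ?_ measurable_const
  · refine MeasurableSet.inter ?_ (MeasurableSet.inter ?_ ?_)
    · refine (MeasurableSet.iInter fun i =>
        measurableSet_le (h1 i) (measurable_const (a := (1 : ℝ≥0∞)))).congr ?_
      ext
      simp only [Set.mem_iInter]
      rfl
    · refine (MeasurableSet.iInter fun i =>
        measurableSet_le (h2 i) (measurable_const (a := (1 : ℝ≥0∞)))).congr ?_
      ext
      simp only [Set.mem_iInter]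
      rfl
    · exact measurableSet_lt h3 measurable_const
  · fun_prop

/-- Any discrete transport plan `p` with marginals `a` and `b` is nearly a rational matrix times
the product of the marginals. -/
theorem exists_rat_transport_matrix {a b : I → ℝ≥0∞} {p : I → I → ℝ≥0∞}
    (ha : ∀ i, ∑ j, p i j = a i) (hb : ∀ j, ∑ i, p i j = b j) (hp : ∑ i, ∑ j, p i j = 1)
    {ε : ℝ≥0∞} (hε : ε ≠ 0) :
    ∃ R : I → I → ℚ,
      (∀ i j, (Real.toNNReal (R i j) : ℝ≥0∞) * a i * b j ≤ p i j) ∧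
      (∀ i, ∑ j, (Real.toNNReal (R i j) : ℝ≥0∞) * b j ≤ 1) ∧
      (∀ j, ∑ i, (Real.toNNReal (R i j) : ℝ≥0∞) * a i ≤ 1) ∧
      ∑ i, ∑ j, (Real.toNNReal (R i j) : ℝ≥0∞) * a i * b j < 1 ∧
      1 - ε ≤ ∑ i, ∑ j, (Real.toNNReal (R i j) : ℝ≥0∞) * a i * b j := by
  have pa : ∀ i j, p i j ≤ a i := fun i j => by
    rw [← ha]; exact Finset.single_le_sum (f := fun j => p i j)
      (fun _ _ => zero_le) (Finset.mem_univ j)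
  have pb : ∀ i j, p i j ≤ b j := fun i j => by
    rw [← hb]; exact Finset.single_le_sum (f := fun i => p i j)
      (fun _ _ => zero_le) (Finset.mem_univ i)
  have a1 : ∀ i, a i ≤ 1 := fun i => by
    rw [← hp, ← ha]
    exact Finset.single_le_sum (f := fun i => ∑ j, p i j) (fun _ _ => zero_le) (Finset.mem_univ i)
  have b1 : ∀ i, b i ≤ 1 := fun i => by
    rw [← hp, ← hb, Finset.sum_comm]
    exact Finset.single_le_sum (f := fun j => ∑ i, p i j) (fun _ _ => zero_le) (Finset.mem_univ i)
  have at' : ∀ i, a i ≠ ⊤ := fun i => ((a1 i).trans_lt ENNReal.one_lt_top).ne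
  have bt : ∀ i, b i ≠ ⊤ := fun i => ((b1 i).trans_lt ENNReal.one_lt_top).ne
  have hlt : 1 - ε < 1 := ENNReal.sub_lt_self ENNReal.one_ne_top one_ne_zero hε
  -- Each entry approximates `p i j / (a i * b j)` from below, by a factor between `1 - ε` and `y`.
  -- The bound `y < 1` keeps the total mass strictly below one, so the completion can be normalized.
  obtain ⟨y, hy1, hy2⟩ := exists_between hlt
  have key : ∀ i j, ∃ r : ℚ, (1 - ε) * p i j ≤ (Real.toNNReal r : ℝ≥0∞) * a i * b j ∧
      (Real.toNNReal r : ℝ≥0∞) * a i * b j ≤ y * p i j ∧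
      (p i j = 0 → r = 0) := by
    intro i j
    by_cases h0 : p i j = 0
    · exact ⟨0, by simp [h0]⟩
    have ai : a i ≠ 0 := fun h => h0 (le_antisymm (h ▸ pa i j) (zero_le))
    have bj : b j ≠ 0 := fun h => h0 (le_antisymm (h ▸ pb i j) (zero_le))
    have pt : p i j ≠ ⊤ := ((pa i j).trans_lt (at' i).lt_top).ne
    have c0 : a i * b j ≠ 0 := mul_ne_zero ai bj
    have ct : a i * b j ≠ ⊤ := ENNReal.mul_ne_top (at' i) (bt j)
    have : (1 - ε) * p i j / (a i * b j) < y * p i j / (a i * b j) :=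
      ENNReal.div_lt_div_right c0 ct (ENNReal.mul_lt_mul_left h0 pt hy1)
    obtain ⟨r, -, h1, h2⟩ := ENNReal.lt_iff_exists_rat_btwn.1 this
    refine ⟨r, ?_, ?_, fun h => absurd h h0⟩
    · rw [mul_assoc]
      exact (ENNReal.div_le_iff c0 ct).1 h1.le
    · rw [mul_assoc]
      exact (ENNReal.le_div_iff_mul_le (Or.inl c0) (Or.inl ct)).1 h2.le
  choose R hR1 hR2 hR3 using key
  have hR4 : ∀ i j, (Real.toNNReal (R i j) : ℝ≥0∞) * a i * b j ≤ p i j := fun i j =>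
    (hR2 i j).trans (mul_le_of_le_one_left (zero_le) hy2.le)
  refine ⟨R, hR4, fun i => ?_, fun j => ?_, ?_, ?_⟩
  -- A null row cannot be divided by `a i`; there `p` vanishes and the entries were chosen to be
  -- zero.
  · by_cases h : a i = 0
    · have : ∀ j, R i j = 0 := fun j => hR3 i j (le_antisymm (h ▸ pa i j) (zero_le))
      simp [this]
    · refine (ENNReal.mul_le_mul_iff_right h (at' i)).1 ?_
      rw [mul_one, Finset.mul_sum]
      conv_rhs => rw [← ha]
      exact Finset.sum_le_sum fun j _ => (le_of_eq (by ring)).trans (hR4 i j)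
  · by_cases h : b j = 0
    · have : ∀ i, R i j = 0 := fun i => hR3 i j (le_antisymm (h ▸ pb i j) (zero_le))
      simp [this]
    · refine (ENNReal.mul_le_mul_iff_right h (bt j)).1 ?_
      rw [mul_one, Finset.mul_sum]
      conv_rhs => rw [← hb]
      exact Finset.sum_le_sum fun i _ => (le_of_eq (by ring)).trans (hR4 i j)
  · calc _ ≤ ∑ i, ∑ j, y * p i j := Finset.sum_le_sum fun i _ => Finset.sum_le_sum fun j _ => hR2 i j
      _ = y := by simp only [← Finset.mul_sum, hp, mul_one]
      _ < 1 := hy2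
  · calc 1 - ε = ∑ i, ∑ j, (1 - ε) * p i j := by simp only [← Finset.mul_sum, hp, mul_one]
      _ ≤ _ := Finset.sum_le_sum fun i _ => Finset.sum_le_sum fun j _ => hR1 i j

end TransportDensity

/-! ### Coupling kernels with cellwise constant densities. -/

section TransportKernel

theorem isProbabilityMeasure_of_map_fst {X Y : Type*} [MeasurableSpace X] [MeasurableSpace Y]
    {π : Measure (X × Y)} {μ : Measure X} [IsProbabilityMeasure μ] (h : π.map Prod.fst = μ) :
    IsProbabilityMeasure π := by
  subst h
  exact Measure.isProbabilityMeasure_of_map Prod.fst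

theorem lintegral_comp_eq_sum {Z I : Type*} [MeasurableSpace Z] [Fintype I] [MeasurableSpace I]
    [MeasurableSingletonClass I] (α : Measure Z) {c : Z → I} (hc : Measurable c) (g : I → ℝ≥0∞) :
    ∫⁻ z, g (c z) ∂α = ∑ i, g i * α (c ⁻¹' {i}) := by
  rw [← lintegral_map (f := g) (measurable_of_countable _) hc, lintegral_fintype]
  exact Finset.sum_congr rfl fun i _ => by rw [Measure.map_apply hc (measurableSet_singleton i)]

theorem sum_measure_preimage_singleton_eq_one {Z I : Type*} [MeasurableSpace Z] [Fintype I]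
    [MeasurableSpace I] [MeasurableSingletonClass I] (α : Measure Z) [IsProbabilityMeasure α]
    {c : Z → I} (hc : Measurable c) : ∑ i, α (c ⁻¹' {i}) = 1 := by
  simpa using (lintegral_comp_eq_sum α hc (fun _ => 1)).symm

variable {A Z I : Type*} [MeasurableSpace A] [MeasurableSpace Z] [Fintype I] [MeasurableSpace I]
  [MeasurableSingletonClass I]

/-- The density of `transportKernel`. -/
noncomputable def transportKernelDensity (κ η : Kernel A Z) (c : Z → I) (Q : I → I → ℝ≥0) (x : A)
    (p : Z × Z) : ℝ≥0∞ :=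
  transportDensity Q (fun i => κ x (c ⁻¹' {i})) (fun i => η x (c ⁻¹' {i})) (c p.1) (c p.2)

theorem measurable_transportKernelDensity (κ η : Kernel A Z) {c : Z → I} (hc : Measurable c)
    (Q : I → I → ℝ≥0) : Measurable (Function.uncurry (transportKernelDensity κ η c Q)) := by
  have h : Measurable fun q : A × (I × I) => transportDensity Q (fun i => κ q.1 (c ⁻¹' {i}))
      (fun i => η q.1 (c ⁻¹' {i})) q.2.1 q.2.2 :=
    measurable_from_prod_countable_left fun y => measurable_transportDensity Q
      (fun i => κ.measurable_coe (hc (measurableSet_singleton i)))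
      (fun i => η.measurable_coe (hc (measurableSet_singleton i))) y.1 y.2
  have hg : Measurable fun q : A × (Z × Z) => (q.1, (c q.2.1, c q.2.2)) :=
    measurable_fst.prodMk ((hc.comp (measurable_fst.comp measurable_snd)).prodMk
      (hc.comp (measurable_snd.comp measurable_snd)))
  have h' := h.comp hg
  exact h'

/-- The coupling of two kernels with the cellwise constant density `transportDensity` with respect
to the product. -/
noncomputable def transportKernel (κ η : Kernel A Z) [IsMarkovKernel κ] [IsMarkovKernel η]
    (c : Z → I) (Q : I → I → ℝ≥0) : Kernel A (Z × Z) :=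
  (κ ×ₖ η).withDensity (transportKernelDensity κ η c Q)

variable (κ η : Kernel A Z) [IsMarkovKernel κ] [IsMarkovKernel η] {c : Z → I} (hc : Measurable c)
  (Q : I → I → ℝ≥0)

include hc in
theorem lintegral_transportKernel {f : Z × Z → ℝ≥0∞} (hf : Measurable f) (x : A) :
    ∫⁻ p, f p ∂(transportKernel κ η c Q x) =
      ∫⁻ p, transportKernelDensity κ η c Q x p * f p ∂((κ x).prod (η x)) := by
  rw [transportKernel, Kernel.lintegral_withDensity _
    (measurable_transportKernelDensity κ η hc Q) _ hf, Kernel.prod_apply]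

include hc in
theorem map_fst_transportKernel (x : A) : (transportKernel κ η c Q x).map Prod.fst = κ x := by
  have hm := (measurable_transportKernelDensity κ η hc Q).of_uncurry_left (x := x)
  refine Measure.ext_of_lintegral _ fun f hf => ?_
  rw [lintegral_map hf measurable_fst,
    lintegral_transportKernel κ η hc Q (f := fun p => f p.1)
      (hf.comp measurable_fst),
    lintegral_prod (fun p => transportKernelDensity κ η c Q x p * f p.1)
      (hm.mul (hf.comp measurable_fst)).aemeasurable]
  refine lintegral_congr fun z => ?_
  have hz : Measurable fun y => transportKernelDensity κ η c Q x (z, y) :=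
    hm.comp measurable_prodMk_left
  dsimp only
  rw [lintegral_mul_const _ hz]
  unfold transportKernelDensity
  rw [lintegral_comp_eq_sum (η x) hc (fun j => transportDensity Q _ _ (c z) j),
    sum_transportDensity_mul _ _ _ (sum_measure_preimage_singleton_eq_one _ hc), one_mul]

include hc in
theorem map_snd_transportKernel (x : A) : (transportKernel κ η c Q x).map Prod.snd = η x := by
  have hm := (measurable_transportKernelDensity κ η hc Q).of_uncurry_left (x := x)
  refine Measure.ext_of_lintegral _ fun f hf => ?_
  rw [lintegral_map hf measurable_snd,
    lintegral_transportKernel κ η hc Q (f := fun p => f p.2)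
      (hf.comp measurable_snd),
    lintegral_prod_symm (fun p => transportKernelDensity κ η c Q x p * f p.2)
      (hm.mul (hf.comp measurable_snd)).aemeasurable]
  refine lintegral_congr fun z => ?_
  have hz : Measurable fun y => transportKernelDensity κ η c Q x (y, z) :=
    hm.comp measurable_prodMk_right
  dsimp only
  rw [lintegral_mul_const _ hz]
  unfold transportKernelDensity
  rw [lintegral_comp_eq_sum (κ x) hc (fun i => transportDensity Q _ _ i (c z)),
    sum_mul_transportDensity _ _ _ (sum_measure_preimage_singleton_eq_one _ hc), one_mul]

theorem lintegral_comp_prod_eq_sum {Z I : Type*} [MeasurableSpace Z] [Fintype I]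
    [MeasurableSpace I] [MeasurableSingletonClass I] (α β : Measure Z) [SFinite α] [SFinite β]
    {c : Z → I} (hc : Measurable c) (g : I → I → ℝ≥0∞) :
    ∫⁻ p, g (c p.1) (c p.2) ∂(α.prod β) =
      ∑ i, ∑ j, g i j * α (c ⁻¹' {i}) * β (c ⁻¹' {j}) := by
  have hm : Measurable fun p : Z × Z => g (c p.1) (c p.2) :=
    (measurable_of_countable fun q : I × I => g q.1 q.2).comp
      ((hc.comp measurable_fst).prodMk (hc.comp measurable_snd))
  rw [lintegral_prod _ hm.aemeasurable]
  simp only [lintegral_comp_eq_sum β hc (g _)]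
  rw [lintegral_comp_eq_sum α hc (fun i => ∑ j, g i j * β (c ⁻¹' {j}))]
  simp only [Finset.sum_mul]
  exact Finset.sum_congr rfl fun _ _ => Finset.sum_congr rfl fun _ _ => by ring

-- Discretize `π` on the cells and approximate the discrete plan by a rational matrix. Replacing
-- distances by their suprema over pairs of cells costs at most `2 * ε`; the completion has mass at
-- most `ε` and moves it by at most one.
include hc in
theorem exists_lintegral_transportKernel_le [PseudoEMetricSpace Z]
    (hd : Measurable fun p : Z × Z => edist p.1 p.2) (h1 : ∀ y z : Z, edist y z ≤ 1)
    {ε : ℝ≥0∞} (hε : ε ≠ 0) (hcε : ∀ y z, c y = c z → edist y z ≤ ε) (x : A)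
    (π : Measure (Z × Z)) (hπ1 : π.map Prod.fst = κ x) (hπ2 : π.map Prod.snd = η x) :
    ∃ R : I → I → ℚ,
      ∫⁻ p, edist p.1 p.2 ∂(transportKernel κ η c (fun i j => Real.toNNReal (R i j)) x) ≤
        ∫⁻ p, edist p.1 p.2 ∂π + 3 * ε := by
  have hπ : IsProbabilityMeasure π := isProbabilityMeasure_of_map_fst hπ1
  have hcc : Measurable fun p : Z × Z => (c p.1, c p.2) :=
    (hc.comp measurable_fst).prodMk (hc.comp measurable_snd)
  set p : I → I → ℝ≥0∞ := fun i j => π ((fun p => (c p.1, c p.2)) ⁻¹' {(i, j)}) with hp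
  have hsum : ∀ g : I → I → ℝ≥0∞, ∫⁻ q, g (c q.1) (c q.2) ∂π = ∑ i, ∑ j, g i j * p i j := by
    intro g
    rw [lintegral_comp_eq_sum π hcc (fun q => g q.1 q.2), Fintype.sum_prod_type]
  have ha : ∀ i, ∑ j, p i j = κ x (c ⁻¹' {i}) := by
    classical
    intro i
    rw [← hπ1, Measure.map_apply measurable_fst (hc (measurableSet_singleton i))]
    have := hsum fun i' _ => if i' = i then 1 else 0
    have h2 : ∫⁻ q, (if c q.1 = i then 1 else 0) ∂π = π (Prod.fst ⁻¹' (c ⁻¹' {i})) := by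
      rw [← lintegral_indicator_one (measurable_fst (hc (measurableSet_singleton i)))]
      exact lintegral_congr fun q => by simp [Set.indicator_apply]
    rw [← h2, this]
    simp
  have hb : ∀ j, ∑ i, p i j = η x (c ⁻¹' {j}) := by
    classical
    intro j
    rw [← hπ2, Measure.map_apply measurable_snd (hc (measurableSet_singleton j))]
    have := hsum fun _ j' => if j' = j then 1 else 0
    have h2 : ∫⁻ q, (if c q.2 = j then 1 else 0) ∂π = π (Prod.snd ⁻¹' (c ⁻¹' {j})) := by
      rw [← lintegral_indicator_one (measurable_snd (hc (measurableSet_singleton j)))]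
      exact lintegral_congr fun q => by simp [Set.indicator_apply]
    rw [← h2, this]
    simp
  have hp1 : ∑ i, ∑ j, p i j = 1 := by simpa using (hsum fun _ _ => 1).symm
  obtain ⟨R, hR1, hR2, hR3, hR4, hR5⟩ := exists_rat_transport_matrix ha hb hp1 hε
  refine ⟨R, ?_⟩
  set Q : I → I → ℝ≥0 := fun i j => Real.toNNReal (R i j) with hQ
  set a : I → ℝ≥0∞ := fun i => κ x (c ⁻¹' {i}) with ha'
  set b : I → ℝ≥0∞ := fun i => η x (c ⁻¹' {i}) with hb'
  set m := ∑ i, ∑ j, (Q i j : ℝ≥0∞) * a i * b j with hm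
  set r : I → I → ℝ≥0∞ := fun i j =>
    (1 - ∑ j, (Q i j : ℝ≥0∞) * b j) * (1 - ∑ i, (Q i j : ℝ≥0∞) * a i) / (1 - m) with hr
  have hD : ∀ i j, transportDensity Q a b i j = Q i j + r i j := fun i j =>
    if_pos ⟨hR2, hR3, hR4⟩
  have hr1 : ∑ i, ∑ j, r i j * a i * b j ≤ ε := by
    have h2 : ∑ i, ∑ j, (Q i j + r i j) * a i * b j = 1 := by
      calc _ = ∑ i, (∑ j, (Q i j + r i j) * b j) * a i :=
            Finset.sum_congr rfl fun i _ => by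
              rw [Finset.sum_mul]; exact Finset.sum_congr rfl fun j _ => by ring
        _ = ∑ i, a i := Finset.sum_congr rfl fun i _ => by
              simp only [← hD]
              rw [sum_transportDensity_mul _ _ _ (sum_measure_preimage_singleton_eq_one _ hc),
                one_mul]
        _ = 1 := sum_measure_preimage_singleton_eq_one _ hc
    simp only [add_mul, Finset.sum_add_distrib] at h2
    -- The full density has mass one, so the completion has mass `1 - m`.
    rw [ENNReal.eq_sub_of_add_eq hR4.ne_top ((add_comm _ _).trans h2)]
    exact tsub_le_iff_tsub_le.1 hR5
  set u : I → I → ℝ≥0∞ := fun i j => ⨆ (y : Z) (z : Z) (_ : c y = i ∧ c z = j), edist y z with hu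
  have hu1 : ∀ y z, edist y z ≤ u (c y) (c z) := fun y z =>
    le_iSup_of_le y (le_iSup_of_le z (le_iSup_of_le ⟨rfl, rfl⟩ le_rfl))
  have hu2 : ∀ y z, u (c y) (c z) ≤ edist y z + 2 * ε := fun y z => by
    refine iSup_le fun y' => iSup_le fun z' => iSup_le fun h => ?_
    calc edist y' z' ≤ edist y' y + edist y z + edist z z' := edist_triangle4 _ _ _ _
      _ ≤ ε + edist y z + ε := by gcongr; exacts [hcε _ _ h.1, hcε _ _ h.2.symm]
      _ = _ := by ring
  have hmu : Measurable fun q : Z × Z => (Q (c q.1) (c q.2) : ℝ≥0∞) * u (c q.1) (c q.2) :=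
    (measurable_of_countable fun q : I × I => (Q q.1 q.2 : ℝ≥0∞) * u q.1 q.2).comp hcc
  rw [lintegral_transportKernel κ η hc Q hd]
  calc _ ≤ ∫⁻ q, ((Q (c q.1) (c q.2) : ℝ≥0∞) * u (c q.1) (c q.2) + r (c q.1) (c q.2))
          ∂((κ x).prod (η x)) := by
        refine lintegral_mono fun q => ?_
        change transportDensity Q a b _ _ * _ ≤ _
        rw [hD, add_mul]
        gcongr
        · exact hu1 _ _
        · exact mul_le_of_le_one_right zero_le (h1 _ _)
    _ = ∑ i, ∑ j, (Q i j : ℝ≥0∞) * u i j * a i * b j + ∑ i, ∑ j, r i j * a i * b j := by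
        rw [lintegral_add_left hmu,
          lintegral_comp_prod_eq_sum _ _ hc fun i j => (Q i j : ℝ≥0∞) * u i j,
          lintegral_comp_prod_eq_sum _ _ hc r]
    _ ≤ ∑ i, ∑ j, u i j * p i j + ε := by
        refine add_le_add (Finset.sum_le_sum fun i _ => Finset.sum_le_sum fun j _ => ?_) hr1
        calc (Q i j : ℝ≥0∞) * u i j * a i * b j = u i j * (Q i j * a i * b j) := by ring
          _ ≤ _ := by gcongr; exact hR1 i j
    _ = ∫⁻ q, u (c q.1) (c q.2) ∂π + ε := by rw [hsum]
    _ ≤ ∫⁻ q, (edist q.1 q.2 + 2 * ε) ∂π + ε := by gcongr with q; exact hu2 _ _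
    _ = ∫⁻ q, edist q.1 q.2 ∂π + 3 * ε := by
        rw [lintegral_add_right _ measurable_const]
        simp only [lintegral_const, measure_univ, mul_one]
        ring

end TransportKernel

/-! ### Measurable choice of couplings, and the triangle inequality. -/

section Selection

/-- There are measurable partitions into finitely many cells of arbitrarily small diameter. -/
def HasFineMeasurablePartitions (Z : Type*) [PseudoEMetricSpace Z] [MeasurableSpace Z] : Prop :=
  ∀ ε : ℝ≥0∞, ε ≠ 0 → ∃ (N : ℕ) (c : Z → Fin N), Measurable c ∧
    ∀ y z, c y = c z → edist y z ≤ ε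

variable {A Z : Type*} [MeasurableSpace A] [MeasurableSpace Z] [PseudoEMetricSpace Z]

/-- Partitions of mesh 1/(n+1) paired with rational matrices form a countable set that does not
depend on the parameter `x`. The infimum over all couplings thereby becomes a countable infimum of
measurable functions. -/
theorem exists_seq_coupling_kernel (hZ : HasFineMeasurablePartitions Z)
    (hd : Measurable fun p : Z × Z => edist p.1 p.2) (h1 : ∀ y z : Z, edist y z ≤ 1)
    (κ η : Kernel A Z) [IsMarkovKernel κ] [IsMarkovKernel η] :
    ∃ γ : ℕ → Kernel A (Z × Z),
      (∀ n x, (γ n x).map Prod.fst = κ x ∧ (γ n x).map Prod.snd = η x) ∧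
      ∀ x, wasserstein (κ x) (η x) = ⨅ n, ∫⁻ p, edist p.1 p.2 ∂(γ n x) := by
  have hpos : ∀ n : ℕ, ((n : ℝ≥0∞) + 1)⁻¹ ≠ 0 := fun n => by simp
  choose N c hc hcd using fun n : ℕ => hZ _ (hpos n)
  obtain ⟨e, he⟩ := exists_surjective_nat ((n : ℕ) × (Fin (N n) → Fin (N n) → ℚ))
  refine ⟨fun n => transportKernel κ η (c (e n).1) (fun i j => Real.toNNReal ((e n).2 i j)),
    fun n x => ⟨map_fst_transportKernel _ _ (hc _) _ x, map_snd_transportKernel _ _ (hc _) _ x⟩,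
    fun x => le_antisymm (le_iInf fun n => iInf₂_le _ ⟨map_fst_transportKernel _ _ (hc _) _ x,
      map_snd_transportKernel _ _ (hc _) _ x⟩) (le_iInf₂ fun π hπ => ?_)⟩
  refine ENNReal.le_of_forall_pos_le_add fun δ hδ _ => ?_
  obtain ⟨n, hn⟩ := ENNReal.exists_inv_nat_lt (a := (δ : ℝ≥0∞) / 3)
    (ENNReal.div_pos (by simpa using hδ.ne') (by simp)).ne'
  have hn' : 3 * ((n : ℝ≥0∞) + 1)⁻¹ ≤ δ := by
    rw [mul_comm]
    refine (ENNReal.le_div_iff_mul_le (by simp) (by simp)).1 (le_trans ?_ hn.le)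
    exact ENNReal.inv_le_inv.2 le_self_add
  obtain ⟨R, hR⟩ := exists_lintegral_transportKernel_le κ η (hc n) hd h1 (hpos n) (hcd n) x π
    hπ.1 hπ.2
  obtain ⟨k, hk⟩ := he ⟨n, R⟩
  refine (iInf_le _ k).trans ?_
  beta_reduce
  rw [hk]
  exact hR.trans (by gcongr)

theorem measurable_wasserstein_kernel (hZ : HasFineMeasurablePartitions Z)
    (hd : Measurable fun p : Z × Z => edist p.1 p.2) (h1 : ∀ y z : Z, edist y z ≤ 1)
    (κ η : Kernel A Z) [IsMarkovKernel κ] [IsMarkovKernel η] :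
    Measurable fun x => wasserstein (κ x) (η x) := by
  obtain ⟨γ, -, h⟩ := exists_seq_coupling_kernel hZ hd h1 κ η
  simp only [h]
  exact Measurable.iInf fun n => hd.lintegral_kernel

theorem exists_coupling_kernel_le (hZ : HasFineMeasurablePartitions Z)
    (hd : Measurable fun p : Z × Z => edist p.1 p.2) (h1 : ∀ y z : Z, edist y z ≤ 1)
    (κ η : Kernel A Z) [IsMarkovKernel κ] [IsMarkovKernel η] {ε : ℝ≥0∞} (hε : ε ≠ 0) :
    ∃ γ : Kernel A (Z × Z), IsMarkovKernel γ ∧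
      (∀ x, (γ x).map Prod.fst = κ x) ∧ (∀ x, (γ x).map Prod.snd = η x) ∧
      ∀ x, ∫⁻ p, edist p.1 p.2 ∂(γ x) ≤ wasserstein (κ x) (η x) + ε := by
  classical
  obtain ⟨γ, hγ, h⟩ := exists_seq_coupling_kernel hZ hd h1 κ η
  have hw := measurable_wasserstein_kernel hZ hd h1 κ η
  have hex : ∀ x, ∃ n, ∫⁻ p, edist p.1 p.2 ∂(γ n x) ≤ wasserstein (κ x) (η x) + ε := by
    intro x
    have ht : wasserstein (κ x) (η x) ≠ ⊤ := by
      rw [h]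
      have : IsProbabilityMeasure (γ 0 x) := isProbabilityMeasure_of_map_fst (hγ 0 x).1
      refine (lt_of_le_of_lt (iInf_le _ 0) (lt_of_le_of_lt (lintegral_mono fun p => h1 _ _) ?_)).ne
      simp
    have : ⨅ n, ∫⁻ p, edist p.1 p.2 ∂(γ n x) < wasserstein (κ x) (η x) + ε := by
      rw [← h]; exact ENNReal.lt_add_right ht hε
    obtain ⟨n, hn⟩ := iInf_lt_iff.1 this
    exact ⟨n, hn.le⟩
  -- Selecting the first admissible index is measurable, as each admissibility condition is.
  have hn : Measurable fun x => Nat.find (hex x) :=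
    measurable_find hex fun n => measurableSet_le hd.lintegral_kernel (hw.add measurable_const)
  have hm : Measurable fun q : A × ℕ => γ q.2 q.1 :=
    measurable_from_prod_countable_left fun n => (γ n).measurable
  refine ⟨⟨fun x => γ (Nat.find (hex x)) x, hm.comp (measurable_id.prodMk hn)⟩,
    ⟨fun x => isProbabilityMeasure_of_map_fst (hγ _ x).1⟩, fun x => (hγ _ x).1, fun x => (hγ _ x).2, fun x => Nat.find_spec (hex x)⟩

/-- The triangle inequality, by gluing couplings. -/
theorem wasserstein_triangle [StandardBorelSpace Z]
    (hd : Measurable fun p : Z × Z => edist p.1 p.2) (α β γ : Measure Z)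
    [IsProbabilityMeasure α] [IsProbabilityMeasure β] [IsProbabilityMeasure γ] :
    wasserstein α γ ≤ wasserstein α β + wasserstein β γ := by
  have : Nonempty Z := nonempty_of_isProbabilityMeasure α
  have key : ∀ π₁ π₂ : Measure (Z × Z), (π₁.map Prod.fst = α ∧ π₁.map Prod.snd = β) →
      (π₂.map Prod.fst = β ∧ π₂.map Prod.snd = γ) →
      wasserstein α γ ≤ ∫⁻ p, edist p.1 p.2 ∂π₁ + ∫⁻ p, edist p.1 p.2 ∂π₂ := by
    intro π₁ π₂ h₁ h₂
    have : IsProbabilityMeasure π₁ := isProbabilityMeasure_of_map_fst h₁.1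
    have : IsProbabilityMeasure π₂ := isProbabilityMeasure_of_map_fst h₂.1
    have hint : ∀ f : Z × Z → ℝ≥0∞, Measurable f →
        ∫⁻ p, ∫⁻ z, f (p.2, z) ∂(π₂.condKernel p.2) ∂π₁ = ∫⁻ p, f p ∂π₂ := by
      intro f hf
      have hm : Measurable fun y => ∫⁻ z, f (y, z) ∂(π₂.condKernel y) :=
        hf.lintegral_kernel_prod_right'
      rw [← Measure.lintegral_condKernel hf, Measure.fst, h₂.1, ← h₁.2,
        lintegral_map hm measurable_snd]
    have hg : Measurable fun q : (Z × Z) × Z => (q.1.1, q.2) :=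
      (measurable_fst.comp measurable_fst).prodMk measurable_snd
    -- The glued coupling draws (x, y) from `π₁`, then z from `π₂` conditioned on y, and keeps (x,
    -- z).
    have hglue : ∀ f : Z × Z → ℝ≥0∞, Measurable f →
        ∫⁻ q, f q ∂((π₁.compProd (π₂.condKernel.comap Prod.snd measurable_snd)).map
          (fun q : (Z × Z) × Z => (q.1.1, q.2))) =
        ∫⁻ p, ∫⁻ z, f (p.1, z) ∂(π₂.condKernel p.2) ∂π₁ := by
      intro f hf
      rw [lintegral_map hf hg, Measure.lintegral_compProd (f := fun q : (Z × Z) × Z => f (q.1.1, q.2)) (hf.comp hg)]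
      rfl
    refine le_trans (iInf₂_le _ ⟨Measure.ext_of_lintegral _ fun f hf => ?_,
      Measure.ext_of_lintegral _ fun f hf => ?_⟩) (le_of_eq_of_le (hglue _ hd) ?_)
    rotate_left
    · rw [lintegral_map hf measurable_fst, hglue (fun p => f p.1) (hf.comp measurable_fst), ← h₁.1,
        lintegral_map hf measurable_fst]
      simp
    · rw [lintegral_map hf measurable_snd, hglue (fun p => f p.2) (hf.comp measurable_snd), ← h₂.2,
        lintegral_map hf measurable_snd]
      exact hint _ (hf.comp measurable_snd)
    · rw [← hint _ hd, ← lintegral_add_left hd]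
      refine lintegral_mono fun p => ?_
      calc ∫⁻ z, edist p.1 z ∂(π₂.condKernel p.2)
          ≤ ∫⁻ z, (edist p.1 p.2 + edist p.2 z) ∂(π₂.condKernel p.2) :=
            lintegral_mono fun z => edist_triangle _ _ _
        _ = _ := by
            rw [lintegral_add_left measurable_const]
            simp
  refine ENNReal.le_of_forall_pos_le_add fun δ hδ ht => ?_
  have ht' := ENNReal.add_lt_top.1 ht
  have hδ2 : (δ : ℝ≥0∞) / 2 ≠ 0 := (ENNReal.half_pos (by simpa using hδ.ne')).ne'
  obtain ⟨π₁, h⟩ := iInf_lt_iff.1 (ENNReal.lt_add_right ht'.1.ne hδ2)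
  obtain ⟨h₁, hπ₁⟩ := iInf_lt_iff.1 h
  obtain ⟨π₂, h⟩ := iInf_lt_iff.1 (ENNReal.lt_add_right ht'.2.ne hδ2)
  obtain ⟨h₂, hπ₂⟩ := iInf_lt_iff.1 h
  calc wasserstein α γ ≤ _ := key π₁ π₂ h₁ h₂
    _ ≤ (wasserstein α β + δ / 2) + (wasserstein β γ + δ / 2) := add_le_add hπ₁.le hπ₂.le
    _ = wasserstein α β + wasserstein β γ + (δ / 2 + δ / 2) := by ring
    _ = _ := by rw [ENNReal.add_halves]

end Selection

/-! ### Path counting and the recursive inequality. -/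

section Paths

variable {K : ℕ} (G : Digraph (Fin K))

theorem numPaths_zero (k : Fin K) : numPaths G k 0 = 1 := by
  unfold numPaths
  rw [Nat.card_eq_one_iff_unique]
  refine ⟨⟨fun p q => Subtype.ext (funext fun i => ?_)⟩, ⟨⟨fun _ => k, rfl, fun i => i.elim0⟩⟩⟩
  rw [Fin.fin_one_eq_zero i, p.2.1, q.2.1]

open Classical in
theorem numPaths_succ (k : Fin K) (ℓ : ℕ) :
    numPaths G k (ℓ + 1) = ∑ j, if G.Adj k j then numPaths G j ℓ else 0 := by
  have e : {p : Fin (ℓ + 1 + 1) → Fin K // p 0 = k ∧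
      ∀ i : Fin (ℓ + 1), G.Adj (p i.castSucc) (p i.succ)} ≃
      Σ j : {j // G.Adj k j}, {p : Fin (ℓ + 1) → Fin K // p 0 = j ∧
        ∀ i : Fin ℓ, G.Adj (p i.castSucc) (p i.succ)} :=
    { toFun := fun p => ⟨⟨p.1 1, by have := p.2.2 0; rwa [Fin.castSucc_zero, p.2.1] at this⟩,
        ⟨fun i => p.1 i.succ, rfl, fun i => by simpa using p.2.2 i.succ⟩⟩
      invFun := fun q => ⟨Fin.cons k q.2.1, rfl, fun i => by
        refine Fin.cases ?_ (fun i => ?_) i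
        · simpa [q.2.2.1] using q.1.2
        · simpa using q.2.2.2 i⟩
      left_inv := fun p => by
        refine Subtype.ext (funext fun i => ?_)
        refine Fin.cases ?_ (fun i => ?_) i
        · simp [p.2.1]
        · simp
      right_inv := fun q => by
        obtain ⟨⟨j, hj⟩, p, hp₀, hp⟩ := q
        have h : p 0 = j := hp₀
        subst h
        rfl }
  unfold numPaths
  rw [Nat.card_congr e, Nat.card_sigma, ← Finset.sum_filter]
  exact (Finset.sum_subtype (p := G.Adj k) _ (by simp) (numPaths G · ℓ)).symm

/-- Such a path would visit K + 1 nodes in strictly increasing order. -/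
theorem numPaths_eq_zero (hG : ∀ i j : Fin K, G.Adj i j → i < j) (k : Fin K) :
    numPaths G k K = 0 := by
  unfold numPaths
  rw [Nat.card_eq_zero]
  refine Or.inl ⟨fun p => ?_⟩
  have hm : StrictMono p.1 := Fin.strictMono_iff_lt_succ.2 fun i => hG _ _ (p.2.2 i)
  simpa using Fintype.card_le_of_injective _ hm.injective

-- The inequality is unrolled `n` times. Exchanging the two sums turns a sum over parents into one
-- over children, and prepending an edge to the paths of length `n` gives those of length `n + 1`.
open Classical in
theorem sum_le_sum_numPaths (L : ℝ≥0) {e w : Fin K → ℝ≥0∞}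
    (h : ∀ k, e k ≤ L * ∑ j ∈ parents G k, e j + w k) (n : ℕ) :
    ∑ k, e k ≤ ∑ ℓ ∈ Finset.range n, (L : ℝ≥0∞) ^ ℓ * ∑ k, numPaths G k ℓ * w k +
      (L : ℝ≥0∞) ^ n * ∑ k, numPaths G k n * e k := by
  induction n with
  | zero => simp [numPaths_zero]
  | succ n ih =>
    refine ih.trans ?_
    rw [Finset.sum_range_succ, add_assoc, pow_succ, mul_assoc, ← mul_add]
    gcongr
    calc ∑ k, (numPaths G k n : ℝ≥0∞) * e k
        ≤ ∑ k, (numPaths G k n : ℝ≥0∞) * (L * ∑ j ∈ parents G k, e j + w k) := by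
          gcongr with k; exact h k
      _ = ∑ k, (numPaths G k n : ℝ≥0∞) * w k +
          L * ∑ k, ∑ j, if G.Adj j k then (numPaths G k n : ℝ≥0∞) * e j else 0 := by
          rw [Finset.mul_sum, ← Finset.sum_add_distrib]
          refine Finset.sum_congr rfl fun k _ => ?_
          rw [← Finset.sum_filter, ← Finset.mul_sum]
          unfold parents
          ring
      _ = _ := by
          rw [Finset.sum_comm]
          congr 2
          refine Finset.sum_congr rfl fun j _ => ?_
          rw [numPaths_succ, Nat.cast_sum, Finset.sum_mul]
          refine Finset.sum_congr rfl fun k _ => ?_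
          split_ifs <;> simp

theorem sum_le_sum_pathConstant_mul (hG : ∀ i j : Fin K, G.Adj i j → i < j) (L : ℝ≥0)
    {e w : Fin K → ℝ≥0∞} (h : ∀ k, e k ≤ L * ∑ j ∈ parents G k, e j + w k) :
    ∑ k, e k ≤ ∑ k, (pathConstant G L k : ℝ≥0∞) * w k := by
  refine (sum_le_sum_numPaths G L h K).trans ?_
  simp only [numPaths_eq_zero G hG, Nat.cast_zero, zero_mul, Finset.sum_const_zero, mul_zero,
    add_zero, Finset.mul_sum]
  rw [Finset.sum_comm]
  refine Finset.sum_le_sum fun k _ => ?_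
  have hc : (pathConstant G L k : ℝ≥0∞) =
      ∑ ℓ ∈ Finset.range (K + 1), (L : ℝ≥0∞) ^ ℓ * numPaths G k ℓ := by
    rw [Finset.sum_range_succ', numPaths_zero, pathConstant]
    push_cast
    rw [Finset.range_eq_Ico, Finset.sum_Ico_add' (fun ℓ => (L : ℝ≥0∞) ^ ℓ * numPaths G k ℓ) 0 K 1]
    rw [add_comm]
    congr 1
    · exact Finset.sum_congr (by ext; simp) fun ℓ _ => mul_comm _ _
    · simp
  rw [hc, Finset.sum_mul]
  simp only [mul_assoc]
  -- The unrolling only produces ℓ < K; `pathConstant` also includes ℓ = K.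
  exact Finset.sum_le_sum_of_subset (Finset.range_mono (Nat.le_succ K))

end Paths

/-! ### Grid partitions of the cube. -/

section Cube

theorem edist_unitInterval_le_one (s t : unitInterval) : edist s t ≤ 1 := by
  rw [edist_dist, Subtype.dist_eq, Real.dist_eq, ← ENNReal.ofReal_one]
  refine ENNReal.ofReal_le_ofReal (abs_le.2 ⟨?_, ?_⟩) <;>
    linarith [s.2.1, s.2.2, t.2.1, t.2.2]

theorem edist_cube_le_one {n : ℕ} (y z : Cube n) : edist y z ≤ 1 :=
  edist_pi_le_iff.2 fun _ => edist_unitInterval_le_one _ _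

theorem hasFineMeasurablePartitions_cube (n : ℕ) : HasFineMeasurablePartitions (Cube n) := by
  intro ε hε
  obtain ⟨m, hm⟩ := ENNReal.exists_inv_nat_lt hε
  have hm0 : (0 : ℝ) < m + 1 := by positivity
  -- The mesh is 1/(m+1). There are `m + 2` indices because the endpoint 1 has floor `m + 1`.
  let c : Cube n → (Fin n → Fin (m + 2)) := fun z i =>
    ⟨⌊(z i : ℝ) * (m + 1)⌋₊, by
      have : (z i : ℝ) * (m + 1) ≤ (m + 1 : ℕ) := by
        push_cast; exact mul_le_of_le_one_left hm0.le (z i).2.2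
      have := Nat.floor_le_of_le this
      omega⟩
  have hc : Measurable c := by
    refine measurable_pi_iff.2 fun i => ?_
    have h : Measurable fun z : Cube n => ⌊(z i : ℝ) * (m + 1)⌋₊ :=
      Nat.measurable_floor.comp
        ((measurable_subtype_coe.comp (measurable_pi_apply i)).mul_const _)
    refine measurable_to_countable' fun j => ?_
    have : (fun z => c z i) ⁻¹' {j} =
        (fun z : Cube n => ⌊(z i : ℝ) * (m + 1)⌋₊) ⁻¹' {(j : ℕ)} := by
      ext z; simp [c, Fin.ext_iff]
    rw [this]
    exact h (measurableSet_singleton _)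
  refine ⟨_, fun z => Fintype.equivFin _ (c z), (measurable_of_countable _).comp hc,
    fun y z h => edist_pi_le_iff.2 fun i => ?_⟩
  have h := congrArg Fin.val (congrFun ((Fintype.equivFin _).injective h) i)
  have hy : 0 ≤ (y i : ℝ) * (m + 1) := mul_nonneg (y i).2.1 hm0.le
  have hz : 0 ≤ (z i : ℝ) * (m + 1) := mul_nonneg (z i).2.1 hm0.le
  have h' : |(y i : ℝ) * (m + 1) - z i * (m + 1)| < 1 := by
    have h1 := Nat.floor_le hy
    have h2 := Nat.lt_floor_add_one ((y i : ℝ) * (m + 1))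
    have h3 := Nat.floor_le hz
    have h4 := Nat.lt_floor_add_one ((z i : ℝ) * (m + 1))
    simp only [c] at h
    rw [h] at h1 h2
    exact abs_lt.2 ⟨by linarith, by linarith⟩
  rw [← sub_mul, abs_mul, abs_of_pos hm0] at h'
  refine le_trans ?_ hm.le
  rw [edist_dist, Subtype.dist_eq, Real.dist_eq]
  calc ENNReal.ofReal |(y i : ℝ) - z i| ≤ ENNReal.ofReal ((m : ℝ) + 1)⁻¹ := by
        refine ENNReal.ofReal_le_ofReal ?_
        rw [← one_div, le_div_iff₀ hm0]
        exact h'.le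
    _ = ((m : ℝ≥0∞) + 1)⁻¹ := by
        rw [ENNReal.ofReal_inv_of_pos hm0, ENNReal.ofReal_add (by positivity) (by positivity)]
        simp
    _ ≤ (m : ℝ≥0∞)⁻¹ := ENNReal.inv_le_inv.2 le_self_add

end Cube

/-! ### Coordinatewise images of sequential sampling. -/

section Intertwine

variable {ι : Type*} [DecidableEq ι] {E F : ι → Type*} [∀ i, MeasurableSpace (E i)]
  [∀ i, MeasurableSpace (F i)]

/-- Drawing a coordinate commutes with `φ`, hence so does drawing a whole list. With `φ` a
projection of pairs, this identifies the marginals of the coupling. -/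
theorem map_resampleList_of_map_eq (κ : ∀ k, Kernel (∀ i, E i) (E k)) [∀ k, IsMarkovKernel (κ k)]
    (θ : ∀ k, Kernel (∀ i, F i) (F k)) [∀ k, IsMarkovKernel (θ k)] {φ : ∀ i, E i → F i}
    (hφ : ∀ i, Measurable (φ i))
    (h : ∀ k x, (κ k x).map (φ k) = θ k (fun i => φ i (x i))) (l : List ι) (x : ∀ i, E i) :
    (resampleList κ l x).map (fun y i => φ i (y i)) = resampleList θ l (fun i => φ i (x i)) := by
  have hΦ : Measurable fun (y : ∀ i, E i) i => φ i (y i) :=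
    measurable_pi_iff.2 fun i => (hφ i).comp (measurable_pi_apply i)
  refine Measure.ext_of_lintegral _ fun f hf => ?_
  rw [lintegral_map hf hΦ]
  induction l generalizing x with
  | nil =>
    have hf' : Measurable fun y : ∀ i, E i => f fun i => φ i (y i) := hf.comp hΦ
    simp [resampleList, Kernel.id_apply, lintegral_dirac' _ hf, lintegral_dirac' _ hf']
  | cons k l ih =>
    have hm : Measurable fun z : F k => ∫⁻ y, f y ∂(resampleList θ l
        (Function.update (fun i => φ i (x i)) k z)) :=
      hf.lintegral_kernel.comp (measurable_update _)
    rw [lintegral_resampleList_cons _ _ _ (f := fun y => f fun i => φ i (y i)) (hf.comp hΦ),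
      lintegral_resampleList_cons _ _ _ hf, ← h,
      lintegral_map hm (hφ k)]
    refine lintegral_congr fun z => ?_
    rw [ih]
    congr 2
    funext i
    by_cases hi : i = k
    · subst hi; simp
    · simp [hi]

end Intertwine

/-! ### Graphical models as sequential sampling. -/

section GraphicalModel

variable {K : ℕ} {d : Fin K → ℕ} (G : Digraph (Fin K))

theorem measurable_toParents (k : Fin K) : Measurable (toParents (d := d) G k) :=
  measurable_pi_iff.2 fun j => measurable_pi_apply (j : Fin K)

theorem toParents_update {k j : Fin K} (hj : j ∉ parents G k) (x : NodeSpace d) (z : Cube (d j)) :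
    toParents G k (Function.update x j z) = toParents G k x := by
  funext i
  have : (i : Fin K) ≠ j := fun h => hj (h ▸ i.2)
  simp [toParents, this]

theorem notMem_of_finRange_eq {l₁ l₂ : List (Fin K)} {k : Fin K}
    (h : List.finRange K = l₁ ++ k :: l₂) : k ∉ l₂ := by
  have := List.nodup_finRange K
  rw [h] at this
  exact (List.nodup_cons.1 (List.nodup_append.1 this).2.1).1

theorem notMem_parents_of_finRange_eq (hG : ∀ i j : Fin K, G.Adj i j → i < j)
    {l₁ l₂ : List (Fin K)} {k : Fin K} (h : List.finRange K = l₁ ++ k :: l₂) :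
    ∀ j ∈ k :: l₂, j ∉ parents G k := by
  intro j hj hjk
  have hjk : j < k := hG _ _ (by simpa [parents] using hjk)
  have hp := List.pairwise_lt_finRange K
  rw [h] at hp
  rcases List.mem_cons.1 hj with rfl | hj
  · exact lt_irrefl _ hjk
  · exact lt_asymm hjk ((List.pairwise_cons.1 (List.pairwise_append.1 hp).2.1).1 j hj)

/-- The kernel `κ`, as a kernel on the whole space. -/
noncomputable abbrev nodeKernel (κ : ∀ k : Fin K, Kernel (ParentSpace d G k) (Cube (d k)))
    (k : Fin K) : Kernel (NodeSpace d) (Cube (d k)) :=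
  (κ k).comap (toParents G k) (measurable_toParents G k)

theorem iteratedIntegral_eq_lintegral
    (κ : ∀ k : Fin K, Kernel (ParentSpace d G k) (Cube (d k))) [∀ k, IsMarkovKernel (κ k)]
    {f : NodeSpace d → ℝ≥0∞} (hf : Measurable f) (x : NodeSpace d) :
    iteratedIntegral G κ f x =
      ∫⁻ y, f y ∂(resampleList (nodeKernel G κ) (List.finRange K) x) := by
  unfold iteratedIntegral
  generalize List.finRange K = l
  induction l generalizing x with
  | nil => simp [resampleList, Kernel.id_apply, lintegral_dirac' _ hf]
  | cons k l ih =>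
    rw [lintegral_resampleList_cons _ _ _ hf]
    simp only [List.foldr_cons, ih, nodeKernel, Kernel.comap_apply]

/-- The law in a graphical model is obtained by sampling the nodes successively from any versions
of the conditional distributions. -/
theorem resampleList_nodeKernel_eq (hG : ∀ i j : Fin K, G.Adj i j → i < j)
    {μ : Measure (NodeSpace d)} (hμ : IsGraphicalModel G μ)
    (κ : ∀ k : Fin K, Kernel (ParentSpace d G k) (Cube (d k))) [∀ k, IsMarkovKernel (κ k)]
    (hκ : ∀ k, IsRegularConditional G μ k (κ k)) (x : NodeSpace d) :
    resampleList (nodeKernel G κ) (List.finRange K) x = μ := by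
  obtain ⟨hprob, κ', hκ', hint⟩ := hμ
  have := fun k => (hκ' k).isMarkovKernel
  have hμ' : resampleList (nodeKernel G κ') (List.finRange K) x = μ :=
    Measure.ext_of_lintegral _ fun f hf => by
      rw [hint f hf x, iteratedIntegral_eq_lintegral G κ' hf]
  rw [← hμ', eq_comm]
  refine resampleList_congr_ae _ _ _ _ fun l₁ k l₂ hl => ?_
  have hae : κ' k =ᵐ[μ.map (toParents G k)] κ k :=
    Kernel.ae_eq_of_compProd_eq ((hκ' k).disintegration.symm.trans (hκ k).disintegration)
  -- All parents of `k` lie in `l₁`, so their law under `μ` is their law just before `k` is drawn.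
  rw [← hμ', hl, map_resampleList_append_of_invariant _ _ _ (measurable_toParents G k)
    fun j hj y z => toParents_update G (notMem_parents_of_finRange_eq G hG hl j hj) y z] at hae
  filter_upwards [ae_of_ae_map (measurable_toParents G k).aemeasurable hae] with y hy
  simpa using hy

end GraphicalModel

/-! ### The coupling and the final estimate. -/

section Main

theorem wasserstein_self_eq_zero {E : Type*} [PseudoEMetricSpace E] [MeasurableSpace E]
    (hd : Measurable fun p : E × E => edist p.1 p.2) (μ : Measure E) : wasserstein μ μ = 0 := by
  have hm : Measurable fun x : E => (x, x) := measurable_id.prodMk measurable_id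
  refine le_antisymm (iInf₂_le_of_le (μ.map fun x => (x, x)) ⟨?_, ?_⟩ ?_) zero_le
  · rw [Measure.map_map measurable_fst hm]; exact Measure.map_id
  · rw [Measure.map_map measurable_snd hm]; exact Measure.map_id
  · rw [lintegral_map hd hm]; simp

variable {K : ℕ} {d : Fin K → ℕ} (G : Digraph (Fin K))

/-- The projection of a family of pairs to the two families of parent variables. -/
def pairToParents (k : Fin K) (p : ∀ i, Cube (d i) × Cube (d i)) :
    ParentSpace d G k × ParentSpace d G k :=
  (toParents G k fun i => (p i).1, toParents G k fun i => (p i).2)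

theorem measurable_pairToParents (k : Fin K) : Measurable (pairToParents (d := d) G k) := by
  unfold pairToParents toParents
  fun_prop

theorem pairToParents_update {k j : Fin K} (hj : j ∉ parents G k)
    (p : ∀ i, Cube (d i) × Cube (d i)) (z : Cube (d j) × Cube (d j)) :
    pairToParents G k (Function.update p j z) = pairToParents G k p := by
  have : ∀ i : parents G k, (i : Fin K) ≠ j := fun i h => hj (h ▸ i.2)
  refine Prod.ext ?_ ?_ <;> funext i <;> simp [pairToParents, toParents, this i]

theorem edist_pairToParents_le (k : Fin K) (p : ∀ i, Cube (d i) × Cube (d i)) :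
    edist (pairToParents G k p).1 (pairToParents G k p).2 ≤
      ∑ j ∈ parents G k, edist (p j).1 (p j).2 :=
  edist_pi_le_iff.2 fun i =>
    Finset.single_le_sum (f := fun j => edist (p j).1 (p j).2) (fun _ _ => zero_le) i.2

theorem edist_le_sum (x y : NodeSpace d) : edist x y ≤ ∑ k, edist (x k) (y k) :=
  edist_pi_le_iff.2 fun i =>
    Finset.single_le_sum (f := fun j => edist (x j) (y j)) (fun _ _ => zero_le) (Finset.mem_univ i)

theorem measurable_edist_eval (k : Fin K) :
    Measurable fun p : NodeSpace d × NodeSpace d => edist (p.1 k) (p.2 k) := by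
  have h1 : Measurable fun p : NodeSpace d × NodeSpace d => p.1 k := by fun_prop
  have h2 : Measurable fun p : NodeSpace d × NodeSpace d => p.2 k := by fun_prop
  exact h1.edist h2

/-- For every `ε > 0` there is a coupling whose expected distances at the nodes satisfy the
recursive inequality along the graph. -/
theorem exists_coupling_lintegral_edist_le (hG : ∀ i j : Fin K, G.Adj i j → i < j)
    {μ ν : Measure (NodeSpace d)} (hμ : IsGraphicalModel G μ) (hν : IsGraphicalModel G ν)
    {κ η : ∀ k : Fin K, Kernel (ParentSpace d G k) (Cube (d k))}
    (hκ : ∀ k, IsRegularConditional G μ k (κ k)) (hη : ∀ k, IsRegularConditional G ν k (η k))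
    {L : ℝ≥0} (hL : ∀ k (a b : ParentSpace d G k),
      wasserstein (κ k a) (κ k b) ≤ (L : ℝ≥0∞) * edist a b) {ε : ℝ≥0∞} (hε : ε ≠ 0) :
    ∃ π : Measure (NodeSpace d × NodeSpace d),
      (π.map Prod.fst = μ ∧ π.map Prod.snd = ν) ∧
      ∀ k, ∫⁻ p, edist (p.1 k) (p.2 k) ∂π ≤
        L * ∑ j ∈ parents G k, ∫⁻ p, edist (p.1 j) (p.2 j) ∂π +
          (∫⁻ y, wasserstein (κ k (toParents G k y)) (η k (toParents G k y)) ∂ν + ε) := by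
  have hκm := fun k => (hκ k).isMarkovKernel
  have hηm := fun k => (hη k).isMarkovKernel
  have hd : ∀ k, Measurable fun p : Cube (d k) × Cube (d k) => edist p.1 p.2 :=
    fun k => measurable_edist
  choose γ hγm hγ1 hγ2 hγ using fun k => exists_coupling_kernel_le
    (hasFineMeasurablePartitions_cube (d k)) (hd k) edist_cube_le_one
    ((κ k).comap (Prod.fst : ParentSpace d G k × ParentSpace d G k → _) measurable_fst)
    ((η k).comap (Prod.snd : ParentSpace d G k × ParentSpace d G k → _) measurable_snd) hε
  let δ : ∀ k, Kernel (∀ i, Cube (d i) × Cube (d i)) (Cube (d k) × Cube (d k)) :=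
    fun k => (γ k).comap (pairToParents G k) (measurable_pairToParents G k)
  -- The starting point is arbitrary: every coordinate is overwritten before it is read.
  let ρ := resampleList δ (List.finRange K) (fun _ => (fun _ => 0, fun _ => 0))
  have hfst : ρ.map (fun p i => (p i).1) = μ := by
    rw [map_resampleList_of_map_eq δ (nodeKernel G κ) (φ := fun i => Prod.fst)
      (fun i => measurable_fst) (fun k x => hγ1 k _)]
    exact resampleList_nodeKernel_eq G hG hμ κ hκ _
  have hsnd : ρ.map (fun p i => (p i).2) = ν := by
    rw [map_resampleList_of_map_eq δ (nodeKernel G η) (φ := fun i => Prod.snd)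
      (fun i => measurable_snd) (fun k x => hγ2 k _)]
    exact resampleList_nodeKernel_eq G hG hν η hη _
  have hm1 : Measurable fun (p : ∀ i, Cube (d i) × Cube (d i)) i => (p i).1 :=
    measurable_pi_iff.2 fun i => measurable_fst.comp (measurable_pi_apply i)
  have hm2 : Measurable fun (p : ∀ i, Cube (d i) × Cube (d i)) i => (p i).2 :=
    measurable_pi_iff.2 fun i => measurable_snd.comp (measurable_pi_apply i)
  have he : ∀ k, ∫⁻ p, edist (p.1 k) (p.2 k) ∂(ρ.map fun p =>
      ((fun i => (p i).1 : NodeSpace d), (fun i => (p i).2 : NodeSpace d))) =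
      ∫⁻ p, edist (p k).1 (p k).2 ∂ρ := fun k => by
    rw [lintegral_map (measurable_edist_eval k) (hm1.prodMk hm2)]
  have hmk : ∀ k, Measurable fun p : ∀ i, Cube (d i) × Cube (d i) => edist (p k).1 (p k).2 :=
    fun k => (hd k).comp (measurable_pi_apply k)
  refine ⟨ρ.map fun p => (fun i => (p i).1, fun i => (p i).2), ⟨?_, ?_⟩, fun k => ?_⟩
  · rw [Measure.map_map measurable_fst (hm1.prodMk hm2)]; exact hfst
  · rw [Measure.map_map measurable_snd (hm1.prodMk hm2)]; exact hsnd
  simp only [he]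
  obtain ⟨l₁, l₂, hl⟩ := List.append_of_mem (List.mem_finRange k)
  have hw : Measurable fun b => wasserstein (κ k b) (η k b) :=
    measurable_wasserstein_kernel (hasFineMeasurablePartitions_cube (d k)) (hd k)
      edist_cube_le_one (κ k) (η k)
  have hw' : ∫⁻ y, wasserstein (κ k (toParents G k y)) (η k (toParents G k y)) ∂ν =
      ∫⁻ p, wasserstein (κ k (pairToParents G k p).2) (η k (pairToParents G k p).2) ∂ρ := by
    rw [← hsnd]
    exact lintegral_map (hw.comp (measurable_toParents G k)) hm2
  calc ∫⁻ p, edist (p k).1 (p k).2 ∂ρ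
      = ∫⁻ p, ∫⁻ z, edist z.1 z.2 ∂(γ k (pairToParents G k p)) ∂ρ := by
        have := lintegral_resampleList_eval δ l₁ l₂ k (notMem_of_finRange_eq hl)
          (measurable_pairToParents G k)
          (fun j hj x z =>
            pairToParents_update G (notMem_parents_of_finRange_eq G hG hl j hj) x z)
          (γ k) (fun _ => rfl) (f := fun _ z => edist z.1 z.2) ((hd k).comp measurable_snd)
          (fun _ => (fun _ => 0, fun _ => 0))
        rw [← hl] at this
        exact this
    _ ≤ ∫⁻ p, ((∑ j ∈ parents G k, L * edist (p j).1 (p j).2) +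
          (wasserstein (κ k (pairToParents G k p).2) (η k (pairToParents G k p).2) + ε)) ∂ρ := by
        refine lintegral_mono fun p => (hγ k _).trans ?_
        rw [← add_assoc, ← Finset.mul_sum]
        gcongr
        -- Going through `κ k` at the second parent vector leaves a comparison of `κ k` and `η k` at
        -- one point of law `ν`, which is why the bound integrates against `ν`.
        refine (wasserstein_triangle (hd k) _ (κ k (pairToParents G k p).2) _).trans ?_
        gcongr
        · exact (hL k _ _).trans (by gcongr; exact edist_pairToParents_le G k p)
        · exact le_rfl
    _ = _ := by
        rw [lintegral_add_left (Finset.measurable_fun_sum _ fun j _ => (hmk j).const_mul _),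
          lintegral_finsetSum _ fun j _ => (hmk j).const_mul _, Finset.mul_sum,
          lintegral_add_right _ measurable_const, hw']
        simp only [lintegral_const_mul _ (hmk _), lintegral_const, measure_univ, mul_one]

end Main

theorem lemma2p4 {K : ℕ} (d : Fin K → ℕ) (G : Digraph (Fin K))
    (hG : ∀ i j : Fin K, G.Adj i j → i < j)
    (μ ν : Measure (NodeSpace d)) (hμ : IsGraphicalModel G μ) (hν : IsGraphicalModel G ν)
    (κ η : ∀ k : Fin K, Kernel (ParentSpace d G k) (Cube (d k)))
    (hκ : ∀ k, IsRegularConditional G μ k (κ k))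
    (hη : ∀ k, IsRegularConditional G ν k (η k))
    (L : ℝ≥0)
    (hL : ∀ (k : Fin K), 1 ≤ (k : ℕ) → ∀ (a b : ParentSpace d G k),
      wasserstein (κ k a) (κ k b) ≤ (L : ℝ≥0∞) * edist a b) :
    wasserstein μ ν ≤
      ∫⁻ y, ∑ k : Fin K, (pathConstant G L k : ℝ≥0∞) *
        wasserstein (κ k (toParents G k y)) (η k (toParents G k y)) ∂ν := by

  have hκm := fun k => (hκ k).isMarkovKernel
  have hηm := fun k => (hη k).isMarkovKernel
  have hd : ∀ k, Measurable fun p : Cube (d k) × Cube (d k) => edist p.1 p.2 :=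
    fun k => measurable_edist
  have hL' : ∀ k (a b : ParentSpace d G k),
      wasserstein (κ k a) (κ k b) ≤ (L : ℝ≥0∞) * edist a b := by
    intro k a b
    by_cases hk : 1 ≤ (k : ℕ)
    · exact hL k hk a b
    -- The first node has no parents, so its parent space is a single point.
    · have : a = b := funext fun j => by
        have := hG j k (by simpa [parents] using j.2)
        omega
      rw [this, wasserstein_self_eq_zero (hd k)]
      exact zero_le
  have hw : ∀ k, Measurable fun y =>
      wasserstein (κ k (toParents G k y)) (η k (toParents G k y)) := fun k =>
    (measurable_wasserstein_kernel (hasFineMeasurablePartitions_cube (d k)) (hd k)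
      edist_cube_le_one (κ k) (η k)).comp (measurable_toParents G k)
  rw [lintegral_finsetSum _ fun k _ => (hw k).const_mul _]
  simp only [lintegral_const_mul _ (hw _)]
  refine ENNReal.le_of_forall_pos_le_add fun δ hδ _ => ?_
  set C : ℝ≥0 := ∑ k, pathConstant G L k with hC
  -- The errors at the nodes add up to `C` times this, hence to at most `δ`; adding one covers `C =
  -- 0`, the empty graph.
  have hε : ((δ / (C + 1) : ℝ≥0) : ℝ≥0∞) ≠ 0 := by
    have : 0 < δ / (C + 1) := by positivity
    exact_mod_cast this.ne'
  obtain ⟨π, hπ, he⟩ := exists_coupling_lintegral_edist_le G hG hμ hν hκ hη hL' hε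
  calc wasserstein μ ν ≤ ∫⁻ p, edist p.1 p.2 ∂π := iInf₂_le π hπ
    _ ≤ ∫⁻ p, ∑ k, edist (p.1 k) (p.2 k) ∂π := lintegral_mono fun p => edist_le_sum _ _
    _ = ∑ k, ∫⁻ p, edist (p.1 k) (p.2 k) ∂π := lintegral_finsetSum _ fun k _ => measurable_edist_eval k
    _ ≤ _ := sum_le_sum_pathConstant_mul G hG L he
    _ = ∑ k, (pathConstant G L k : ℝ≥0∞) *
          ∫⁻ y, wasserstein (κ k (toParents G k y)) (η k (toParents G k y)) ∂ν +
        (C : ℝ≥0∞) * ((δ / (C + 1) : ℝ≥0) : ℝ≥0∞) := by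
        simp only [mul_add, Finset.sum_add_distrib, ← Finset.sum_mul, hC,
          ENNReal.ofNNReal_finsetSum]
    _ ≤ _ := by
        gcongr
        have : C * (δ / (C + 1)) ≤ δ := by
          rw [← mul_div_assoc]
          refine div_le_of_le_mul₀ zero_le zero_le ?_
          rw [mul_comm]
          gcongr
          exact le_self_add
        exact_mod_cast this
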